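/- Let $d\ge 0$ be an integer. A Lévy measure on $\mathbb R^d$ is a Borel measure $M$ with $M(\{0\})=0$ and $\int_{\mathbb R^d}(|x|^2\wedge 1)\,M(\mathrm dx)<\infty$. For a Borel measure $\rho$ on $(0,\infty)$ the upsilon transform with dilation measure $\rho$ maps $M$ to the measure $$[\Upsilon_\rho M](B)=\int_0^\infty M(s^{-1}B)\,\rho(\mathrm ds),\qquad B\subset\mathbb R^d\text{ Borel},$$ and its domain $\mathfrak D(\Upsilon_\rho)$ is the set of all Lévy measures $M$ for which $\Upsilon_\rho M$ is again a Lévy measure. For $-\infty<\beta<\alpha<\infty$ and $p>0$ let $\mathfrak T_{\beta\to\alpha,p}=\Upsilon_{\tau}$ with $$\tau(\mathrm ds)=\frac1{K_{\alpha,\beta,p}}\,s^{-\alpha-1}(1-s^p)^{(\alpha-\beta)/p-1}1_{0<s<1}\,\mathrm ds,\qquad K_{\alpha,\beta,p}=\int_0^\infty u^{\alpha-\beta-1}e^{-u^p}\,\mathrm du .$$ For $0<q<p<\infty$ and $\alpha\in\mathbb R$ let $\mathfrak P_{\alpha,p\to q}=\Upsilon_{\pi}$ with $$\pi(\mathrm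 ds)=p\,f_{q/p}(s^{-p})\,s^{-\alpha-p-1}1_{s>0}\,\mathrm ds,$$ where, for $r\in(0,1)$, $f_r$ is the density of the fully right-skewed $r$-stable distribution on $(0,\infty)$, i.e. the probability density with $\int_0^\infty e^{-tx}f_r(x)\,\mathrm dx=e^{-t^r}$ for all $t\ge 0$. 1. If $\beta<\alpha<2$ and $p>0$, then $\mathfrak T_{\beta\to\alpha,p}$ is one-to-one on its domain: if $M,M'\in\mathfrak D(\mathfrak T_{\beta\to\alpha,p})$ and $\mathfrak T_{\beta\to\alpha,p}M=\mathfrak T_{\beta\to\alpha,p}M'$, then $M=M'$. 2. If $0<q<p$ and $\alpha<0$, then $\mathfrak P_{\alpha,p\to q}$ is one-to-one on its domain: if $M,M'\in\mathfrak D(\mathfrak P_{\alpha,p\to q})$ and $\mathfrak P_{\alpha,p\to q}M=\mathfrak P_{\alpha,p\to q}M'$, then $M=M'$. -/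

import Mathlib

namespace UpsilonTransform

open MeasureTheory Set Filter Topology

/-- `f` is (a version of) the density of the fully right-skewed `r`-stable distribution: a
probability density carried by `(0, ∞)` whose Laplace transform is `t ↦ exp (-t ^ r)`. The case
`t = 0` says that the total mass is `1`. -/
structure IsStableDensity (r : ℝ) (f : ℝ → ℝ) : Prop where
  measurable : Measurable f
  nonneg : ∀ x, 0 ≤ f x
  eq_zero : ∀ x, x ≤ 0 → f x = 0
  laplace : ∀ t : ℝ, 0 ≤ t →
    ∫⁻ x in Ioi (0 : ℝ), ENNReal.ofReal (Real.exp (-(t * x)) * f x)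
      = ENNReal.ofReal (Real.exp (-t ^ r))

/- ### Existence of the stable densities

The following facts are only used to show that the density of the one-sided stable law of index
`r` in `(0, 1)` exists, so that it can be chosen in the definition of `stableDensity`. -/

theorem jump_integrableOn {r t : ℝ} (hr0 : 0 < r) (hr1 : r < 1) (ht : 0 < t) :
    IntegrableOn (fun v : ℝ => 1 - Real.exp (-(t * v ^ (-r⁻¹)))) (Ioi 0) := by
  have hm : Measurable (fun v : ℝ => 1 - Real.exp (-(t * v ^ (-r⁻¹)))) := by fun_prop
  have hr : 1 < r⁻¹ := (one_lt_inv₀ hr0).2 hr1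
  have h0 : ∀ v : ℝ, 0 < v → 0 ≤ 1 - Real.exp (-(t * v ^ (-r⁻¹))) := by
    intro v hv
    have : Real.exp (-(t * v ^ (-r⁻¹))) ≤ 1 := by
      apply Real.exp_le_one_iff.2; simp; positivity
    linarith
  rw [← Ioc_union_Ioi_eq_Ioi (zero_le_one (α := ℝ))]
  refine IntegrableOn.union ?_ ?_
  · refine Measure.integrableOn_of_bounded (M := 1) (by simp) hm.aestronglyMeasurable ?_
    filter_upwards [ae_restrict_mem measurableSet_Ioc] with v hv
    rw [Real.norm_of_nonneg (h0 v hv.1)]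
    linarith [Real.exp_pos (-(t * v ^ (-r⁻¹)))]
  · refine Integrable.mono' (((integrableOn_Ioi_rpow_of_lt (a := -r⁻¹) (by linarith)
      zero_lt_one)).const_mul t) hm.aestronglyMeasurable ?_
    filter_upwards [ae_restrict_mem measurableSet_Ioi] with v hv
    have hv' : (0 : ℝ) < v := lt_trans zero_lt_one hv
    rw [Real.norm_of_nonneg (h0 v hv')]
    linarith [Real.one_sub_le_exp_neg (t * v ^ (-r⁻¹))]

theorem jump_scaling {r t : ℝ} (hr0 : 0 < r) (ht : 0 < t) :
    ∫ v in Ioi (0 : ℝ), (1 - Real.exp (-(t * v ^ (-r⁻¹))))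
      = t ^ r * ∫ v in Ioi (0 : ℝ), (1 - Real.exp (-(v ^ (-r⁻¹)))) := by
  have hpos : 0 < t ^ (-r) := Real.rpow_pos_of_pos ht _
  have h := integral_comp_mul_left_Ioi (fun v : ℝ => 1 - Real.exp (-(v ^ (-r⁻¹)))) 0 hpos
  rw [mul_zero, smul_eq_mul, ← Real.rpow_neg ht.le, neg_neg] at h
  rw [← h]
  refine setIntegral_congr_fun measurableSet_Ioi fun v hv => ?_
  have hv' : (0 : ℝ) < v := hv
  have : (t ^ (-r) * v) ^ (-r⁻¹) = t * v ^ (-r⁻¹) := by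
    rw [Real.mul_rpow hpos.le hv'.le, ← Real.rpow_mul ht.le]
    have : -r * -r⁻¹ = 1 := by field_simp
    rw [this, Real.rpow_one]
  simp only [this]

theorem jump_const_pos {r : ℝ} (hr0 : 0 < r) (hr1 : r < 1) :
    0 < ∫ v in Ioi (0 : ℝ), (1 - Real.exp (-(v ^ (-r⁻¹)))) := by
  have hi := jump_integrableOn hr0 hr1 zero_lt_one
  simp only [one_mul] at hi
  have hp : ∀ v : ℝ, 0 < v → 0 < 1 - Real.exp (-(v ^ (-r⁻¹))) := by
    intro v hv
    have : Real.exp (-(v ^ (-r⁻¹))) < 1 := by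
      rw [← Real.exp_zero, Real.exp_lt_exp, neg_lt_zero]; positivity
    linarith
  rw [setIntegral_pos_iff_support_of_nonneg_ae _ hi]
  · have : Ioi (0 : ℝ) ⊆ Function.support (fun v : ℝ => 1 - Real.exp (-(v ^ (-r⁻¹)))) ∩ Ioi 0 :=
      fun v hv => ⟨(hp v hv).ne', hv⟩
    refine lt_of_lt_of_le ?_ (measure_mono this)
    simp
  · filter_upwards [ae_restrict_mem measurableSet_Ioi] with v hv
    exact (hp v hv).le

open unitInterval in
theorem exists_law_unitInterval {r : ℝ} (hr0 : 0 < r) (hr1 : r < 1) :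
    ∃ P : ProbabilityMeasure I, ∀ t : ℝ, 0 < t →
      ∫ z : I, (z : ℝ) ^ t ∂(P : Measure I)
        = Real.exp (-(t ^ r * ∫ v in Ioi (0 : ℝ), (1 - Real.exp (-(v ^ (-r⁻¹)))))) := by
  let g : ℕ → I → I := fun n u => ⟨Real.exp (-((n : ℝ) * (u : ℝ)) ^ (-r⁻¹)), by
    refine ⟨(Real.exp_pos _).le, Real.exp_le_one_iff.2 ?_⟩
    have : 0 ≤ ((n : ℝ) * (u : ℝ)) ^ (-r⁻¹) :=
      Real.rpow_nonneg (mul_nonneg n.cast_nonneg u.2.1) _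
    linarith⟩
  have hg : ∀ n, Measurable (g n) := fun n => by
    refine Measurable.subtype_mk ?_
    fun_prop
  let G : (n : ℕ) → (Fin n → I) → I := fun n u => ∏ i, g n (u i)
  have hG : ∀ n, Measurable (G n) := fun n => by
    refine Finset.measurable_prod _ fun i _ => ?_
    exact (hg n).comp (measurable_pi_apply i)
  let P : ℕ → ProbabilityMeasure I := fun n =>
    ⟨(volume : Measure (Fin n → I)).map (G n),
      Measure.isProbabilityMeasure_map (hG n).aemeasurable⟩
  let U : Ultrafilter (ProbabilityMeasure I) := (hyperfilter ℕ).map P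
  have hU : Tendsto P (hyperfilter ℕ : Filter ℕ) (𝓝 U.lim) := Ultrafilter.le_nhds_lim U
  refine ⟨U.lim, fun t ht => ?_⟩
  have hc : Continuous (fun z : I => (z : ℝ) ^ t) :=
    continuous_subtype_val.rpow_const fun _ => Or.inr ht.le
  have h1 := ProbabilityMeasure.tendsto_iff_forall_integral_tendsto.1 hU
    (BoundedContinuousFunction.mkOfCompact ⟨_, hc⟩)
  simp only [BoundedContinuousFunction.mkOfCompact_apply, ContinuousMap.coe_mk] at h1
  have h2 : ∀ n : ℕ, 0 < n → ∫ z : I, (z : ℝ) ^ t ∂(P n : Measure I)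
      = (1 + (-((n : ℝ)⁻¹ * ∫ v in (0 : ℝ)..n, (1 - Real.exp (-(t * v ^ (-r⁻¹))))))) ^ n := by
    intro n hn
    have e1 : ∫ z : I, (z : ℝ) ^ t ∂(P n : Measure I)
        = ∫ u : Fin n → I, ((G n u : I) : ℝ) ^ t :=
      integral_map (hG n).aemeasurable hc.measurable.aestronglyMeasurable
    have e2 : ∀ u : Fin n → I, ((G n u : I) : ℝ) ^ t = ∏ i, ((g n (u i) : I) : ℝ) ^ t := by
      intro u
      have : ((G n u : I) : ℝ) = ∏ i, ((g n (u i) : I) : ℝ) := by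
        simp only [G]
        exact map_prod (⟨⟨Subtype.val, rfl⟩, fun _ _ => rfl⟩ : I →* ℝ) _ _
      rw [this, Real.finsetProd_rpow _ _ (fun i _ => (g n (u i)).2.1)]
    rw [e1]
    simp_rw [e2]
    rw [integral_fintype_prod_volume_eq_pow (fun u : I => ((g n u : I) : ℝ) ^ t), Fintype.card_fin]
    congr 1
    have e3 : ∫ u : I, ((g n u : I) : ℝ) ^ t
        = ∫ x in (0 : ℝ)..1, Real.exp (-(t * ((n : ℝ) * x) ^ (-r⁻¹))) := by
      rw [intervalIntegral.integral_of_le zero_le_one, ← integral_Icc_eq_integral_Ioc]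
      have := (unitInterval.measurePreserving_coe).integral_comp
        (MeasurableEmbedding.subtype_coe measurableSet_Icc)
        (fun x : ℝ => Real.exp (-(t * ((n : ℝ) * x) ^ (-r⁻¹))))
      rw [← this]
      refine integral_congr_ae (Eventually.of_forall fun u => ?_)
      simp only [g]
      rw [← Real.exp_mul]
      congr 1; ring
    have hn' : (n : ℝ) ≠ 0 := by positivity
    rw [e3, intervalIntegral.integral_comp_mul_left
      (fun v : ℝ => Real.exp (-(t * v ^ (-r⁻¹)))) hn']
    have hint : IntervalIntegrable (fun v : ℝ => 1 - Real.exp (-(t * v ^ (-r⁻¹)))) volume 0 n := by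
      rw [intervalIntegrable_iff_integrableOn_Ioc_of_le n.cast_nonneg]
      exact (jump_integrableOn hr0 hr1 ht).mono_set Ioc_subset_Ioi_self
    have e4 : ∫ v in (0 : ℝ)..n, Real.exp (-(t * v ^ (-r⁻¹)))
        = n - ∫ v in (0 : ℝ)..n, (1 - Real.exp (-(t * v ^ (-r⁻¹)))) := by
      have : ∀ v : ℝ, Real.exp (-(t * v ^ (-r⁻¹)))
          = 1 - (1 - Real.exp (-(t * v ^ (-r⁻¹)))) := fun v => by ring
      rw [intervalIntegral.integral_congr (fun v _ => this v), intervalIntegral.integral_sub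
        (by simp) hint]
      simp
    rw [mul_zero, mul_one, e4, smul_eq_mul]
    field_simp
    ring
  have h3 : Tendsto (fun n : ℕ =>
      (1 + (-((n : ℝ)⁻¹ * ∫ v in (0 : ℝ)..n, (1 - Real.exp (-(t * v ^ (-r⁻¹))))))) ^ n) atTop
      (𝓝 (Real.exp (-(t ^ r * ∫ v in Ioi (0 : ℝ), (1 - Real.exp (-(v ^ (-r⁻¹)))))))) := by
    refine Real.tendsto_one_add_pow_exp_of_tendsto ?_
    rw [← jump_scaling hr0 ht]
    refine Tendsto.congr' ?_ (intervalIntegral_tendsto_integral_Ioi 0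
      (jump_integrableOn hr0 hr1 ht) tendsto_natCast_atTop_atTop).neg
    filter_upwards [eventually_gt_atTop 0] with n hn
    have hn' : (n : ℝ) ≠ 0 := by positivity
    field_simp
  have hle : (hyperfilter ℕ : Filter ℕ) ≤ atTop := by
    rw [← Nat.cofinite_eq_atTop]; exact hyperfilter_le_cofinite
  refine tendsto_nhds_unique h1 ((h3.mono_left hle).congr' ?_)
  filter_upwards [hle (eventually_gt_atTop 0)] with n hn
  exact (h2 n hn).symm

open unitInterval in
theorem exists_stable_law {r : ℝ} (hr0 : 0 < r) (hr1 : r < 1) :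
    ∃ μ : Measure ℝ, IsFiniteMeasure μ ∧ (∀ᵐ y ∂μ, 0 ≤ y) ∧ ∀ t : ℝ, 0 < t →
      ∫⁻ y, ENNReal.ofReal (Real.exp (-(t * y))) ∂μ = ENNReal.ofReal (Real.exp (-t ^ r)) := by
  obtain ⟨P, hP⟩ := exists_law_unitInterval hr0 hr1
  set c := ∫ v in Ioi (0 : ℝ), (1 - Real.exp (-(v ^ (-r⁻¹)))) with hcdef
  have hc : 0 < c := jump_const_pos hr0 hr1
  let a : ℝ := c ^ (-r⁻¹)
  have ha : 0 < a := Real.rpow_pos_of_pos hc _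
  have har : a ^ r * c = 1 := by
    simp only [a]
    rw [← Real.rpow_mul hc.le, neg_mul, inv_mul_cancel₀ hr0.ne', Real.rpow_neg_one,
      inv_mul_cancel₀ hc.ne']
  let φ : I → ℝ := fun z => -(a * Real.log z)
  have hφ : Measurable φ := by fun_prop
  let S : Set I := {z | (z : ℝ) ≠ 0}
  have hS : MeasurableSet S :=
    (measurableSet_eq_fun measurable_subtype_coe measurable_const).compl
  refine ⟨((P : Measure I).restrict S).map φ, inferInstance, ?_, fun t ht => ?_⟩
  · rw [ae_map_iff hφ.aemeasurable measurableSet_Ici]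
    refine Eventually.of_forall fun z => ?_
    simp only [φ]
    have := Real.log_nonpos z.2.1 z.2.2
    nlinarith
  · rw [lintegral_map (by fun_prop) hφ]
    have hat : 0 < a * t := by positivity
    have hcont : Continuous (fun z : I => (z : ℝ) ^ (a * t)) :=
      continuous_subtype_val.rpow_const fun _ => Or.inr hat.le
    have e1 : ∫⁻ z in S, ENNReal.ofReal (Real.exp (-(t * φ z))) ∂(P : Measure I)
        = ∫⁻ z, ENNReal.ofReal ((z : ℝ) ^ (a * t)) ∂(P : Measure I) := by
      rw [← lintegral_indicator hS]
      refine lintegral_congr fun z => ?_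
      by_cases hz : (z : ℝ) = 0
      · rw [indicator_of_notMem (by simpa [S] using hz), hz, Real.zero_rpow hat.ne']; simp
      · rw [indicator_of_mem (by simpa [S] using hz)]
        rw [Real.rpow_def_of_pos (lt_of_le_of_ne z.2.1 (Ne.symm hz))]
        congr 2; simp only [φ]; ring
    rw [e1, ← ofReal_integral_eq_lintegral_ofReal, hP _ hat]
    · congr 3
      rw [Real.mul_rpow ha.le ht.le]
      linear_combination t ^ r * har
    · refine Integrable.of_bound hcont.measurable.aestronglyMeasurable 1
        (Eventually.of_forall fun z => ?_)
      rw [Real.norm_of_nonneg (Real.rpow_nonneg z.2.1 _)]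
      exact Real.rpow_le_one z.2.1 z.2.2 hat.le
    · exact Eventually.of_forall fun z => Real.rpow_nonneg z.2.1 _

theorem lintegral_exp_neg_mul_Ioi {x : ℝ} (hx : 0 < x) (t : ℝ) :
    ∫⁻ s in Ioi t, ENNReal.ofReal (Real.exp (-(s * x)))
      = ENNReal.ofReal (Real.exp (-(t * x)) * x⁻¹) := by
  have hx' : -x < 0 := by linarith
  have h1 := integral_exp_mul_Ioi hx' t
  have h2 := integrableOn_exp_mul_Ioi hx' t
  have e : ∀ s : ℝ, -x * s = -(s * x) := fun s => by ring
  simp only [e] at h1 h2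
  rw [← ofReal_integral_eq_lintegral_ofReal h2 (Eventually.of_forall fun _ => (Real.exp_pos _).le),
    h1]
  congr 1
  field_simp

theorem lintegral_rpow_exp {r s y : ℝ} (hr1 : r < 1) (hs : 0 < s) (hy : 0 ≤ y) :
    ∫⁻ x in Ioi (0 : ℝ), ENNReal.ofReal (Real.exp (-(s * x))) *
        (Ioi y).indicator (fun x => ENNReal.ofReal ((x - y) ^ (-r))) x
      = ENNReal.ofReal (Real.exp (-(s * y))) *
          ENNReal.ofReal (s ^ (r - 1) * Real.Gamma (1 - r)) := by
  have h1r : 0 < 1 - r := by linarith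
  have hG := Real.integral_rpow_mul_exp_neg_mul_Ioi h1r hs
  have hGne : (1 / s) ^ (1 - r) * Real.Gamma (1 - r) ≠ 0 :=
    (mul_pos (Real.rpow_pos_of_pos (by positivity) _) (Real.Gamma_pos_of_pos h1r)).ne'
  have hGi : IntegrableOn (fun u : ℝ => u ^ (1 - r - 1) * Real.exp (-(s * u))) (Ioi 0) := by
    by_contra h
    exact hGne (hG ▸ integral_undef h)
  have e1 : ∀ x : ℝ, (Ioi (0 : ℝ)).indicator (fun x => ENNReal.ofReal (Real.exp (-(s * x))) *
        (Ioi y).indicator (fun x => ENNReal.ofReal ((x - y) ^ (-r))) x) x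
      = (fun u => ENNReal.ofReal (Real.exp (-(s * y))) * (Ioi (0 : ℝ)).indicator
          (fun u => ENNReal.ofReal (u ^ (1 - r - 1) * Real.exp (-(s * u)))) u) (x - y) := by
    intro x
    by_cases hx : y < x
    · have hx0 : 0 < x := lt_of_le_of_lt hy hx
      have hxy : 0 < x - y := by linarith
      simp only [indicator, mem_Ioi, hx, hx0, hxy, if_true]
      rw [← ENNReal.ofReal_mul (Real.exp_pos _).le, ← ENNReal.ofReal_mul (Real.exp_pos _).le]
      congr 1
      have : Real.exp (-(s * x)) = Real.exp (-(s * y)) * Real.exp (-(s * (x - y))) := by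
        rw [← Real.exp_add]; congr 1; ring
      rw [this, show 1 - r - 1 = -r by ring]
      ring
    · have hxy : ¬ 0 < x - y := by linarith
      simp [indicator, hx]
  rw [← lintegral_indicator measurableSet_Ioi, lintegral_congr e1, lintegral_sub_right_eq_self
    (fun u => ENNReal.ofReal (Real.exp (-(s * y))) * (Ioi (0 : ℝ)).indicator
          (fun u => ENNReal.ofReal (u ^ (1 - r - 1) * Real.exp (-(s * u)))) u) y,
    lintegral_const_mul' _ _ ENNReal.ofReal_ne_top, lintegral_indicator measurableSet_Ioi,
    ← ofReal_integral_eq_lintegral_ofReal hGi, hG]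
  · congr 3
    rw [one_div, Real.inv_rpow hs.le, ← Real.rpow_neg hs.le, neg_sub]
  · filter_upwards [ae_restrict_mem measurableSet_Ioi] with u hu
    exact mul_nonneg (Real.rpow_nonneg (le_of_lt hu) _) (Real.exp_pos _).le

theorem lintegral_deriv_exp {r t : ℝ} (hr0 : 0 < r) (ht : 0 ≤ t) :
    ∫⁻ s in Ioi t, ENNReal.ofReal (Real.exp (-s ^ r) * (r * s ^ (r - 1)))
      = ENNReal.ofReal (Real.exp (-t ^ r)) := by
  have hc : ContinuousWithinAt (fun s : ℝ => -Real.exp (-s ^ r)) (Ici t) t := by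
    have : Continuous (fun s : ℝ => -Real.exp (-s ^ r)) := by
      have := Real.continuous_rpow_const hr0.le
      fun_prop
    exact this.continuousWithinAt
  have hd : ∀ s ∈ Ioi t, HasDerivAt (fun s : ℝ => -Real.exp (-s ^ r))
      (Real.exp (-s ^ r) * (r * s ^ (r - 1))) s := by
    intro s hs
    have hs' : 0 < s := lt_of_le_of_lt ht hs
    have := ((Real.hasDerivAt_rpow_const (p := r) (Or.inl hs'.ne')).neg.exp).neg
    have e : Real.exp (-s ^ r) * (r * s ^ (r - 1))
        = -(Real.exp (-s ^ r) * -(r * s ^ (r - 1))) := by ring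
    rw [e]
    exact this
  have hn : ∀ s ∈ Ioi t, 0 ≤ Real.exp (-s ^ r) * (r * s ^ (r - 1)) := by
    intro s hs
    have hs' : 0 < s := lt_of_le_of_lt ht hs
    positivity
  have hl : Tendsto (fun s : ℝ => -Real.exp (-s ^ r)) atTop (𝓝 (-0)) :=
    (Real.tendsto_exp_neg_atTop_nhds_zero.comp (tendsto_rpow_atTop hr0)).neg
  have hi := integrableOn_Ioi_deriv_of_nonneg hc hd hn hl
  rw [← ofReal_integral_eq_lintegral_ofReal hi, integral_Ioi_of_hasDerivAt_of_tendsto hc hd hi hl]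
  · simp
  · filter_upwards [ae_restrict_mem measurableSet_Ioi] with s hs using hn s hs

/-- The stable density exists for every index `r` in `(0, 1)`. -/
theorem exists_isStableDensity {r : ℝ} (hr0 : 0 < r) (hr1 : r < 1) :
    ∃ f : ℝ → ℝ, IsStableDensity r f := by
  obtain ⟨μ, hfin, hpos, hL⟩ := exists_stable_law hr0 hr1
  let k : ℝ → ℝ → ENNReal :=
    fun x y => (Ioi y).indicator (fun x => ENNReal.ofReal ((x - y) ^ (-r))) x
  have hk : Measurable (Function.uncurry k) := by
    have : Function.uncurry k = {p : ℝ × ℝ | p.2 < p.1}.indicator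
        (fun p => ENNReal.ofReal ((p.1 - p.2) ^ (-r))) := by
      ext ⟨x, y⟩; simp [k, indicator]
    rw [this]
    exact Measurable.indicator (by fun_prop) (measurableSet_lt measurable_snd measurable_fst)
  let h : ℝ → ENNReal := fun x => ∫⁻ y, k x y ∂μ
  have hh : Measurable h := hk.lintegral_prod_right'
  have hG : 0 < Real.Gamma (1 - r) := Real.Gamma_pos_of_pos (by linarith)
  let κ : ENNReal := ENNReal.ofReal (r / Real.Gamma (1 - r))
  let F : ℝ → ENNReal := fun x => ENNReal.ofReal x⁻¹ * (κ * h x)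
  have hF : Measurable F := by fun_prop
  have key : ∀ t : ℝ, 0 ≤ t → ∫⁻ x in Ioi (0 : ℝ), ENNReal.ofReal (Real.exp (-(t * x))) * F x
      = ENNReal.ofReal (Real.exp (-t ^ r)) := by
    intro t ht
    calc ∫⁻ x in Ioi (0 : ℝ), ENNReal.ofReal (Real.exp (-(t * x))) * F x
        = ∫⁻ x in Ioi (0 : ℝ), ∫⁻ s in Ioi t, ENNReal.ofReal (Real.exp (-(s * x))) * (κ * h x) := by
          refine setLIntegral_congr_fun measurableSet_Ioi fun x hx => ?_
          rw [lintegral_mul_const _ (by fun_prop), lintegral_exp_neg_mul_Ioi hx,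
            ENNReal.ofReal_mul (Real.exp_pos _).le, mul_assoc]
      _ = ∫⁻ s in Ioi t, ∫⁻ x in Ioi (0 : ℝ), ENNReal.ofReal (Real.exp (-(s * x))) * (κ * h x) :=
          lintegral_lintegral_swap (by fun_prop)
      _ = ∫⁻ s in Ioi t, ENNReal.ofReal (Real.exp (-s ^ r) * (r * s ^ (r - 1))) := by
          refine setLIntegral_congr_fun measurableSet_Ioi fun s hs => ?_
          have hs' : 0 < s := lt_of_le_of_lt ht hs
          calc ∫⁻ x in Ioi (0 : ℝ), ENNReal.ofReal (Real.exp (-(s * x))) * (κ * h x)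
              = κ * ∫⁻ x in Ioi (0 : ℝ), ∫⁻ y, ENNReal.ofReal (Real.exp (-(s * x))) * k x y ∂μ := by
                rw [← lintegral_const_mul' _ _ ENNReal.ofReal_ne_top]
                refine lintegral_congr fun x => ?_
                rw [lintegral_const_mul' _ _ ENNReal.ofReal_ne_top]
                simp only [h]; ring
            _ = κ * ∫⁻ y, (∫⁻ x in Ioi (0 : ℝ), ENNReal.ofReal (Real.exp (-(s * x))) * k x y) ∂μ := by
                rw [lintegral_lintegral_swap]
                exact ((by fun_prop : Measurable fun p : ℝ × ℝ =>
                  ENNReal.ofReal (Real.exp (-(s * p.1)))).mul hk).aemeasurable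
            _ = κ * ∫⁻ y, ENNReal.ofReal (Real.exp (-(s * y))) *
                  ENNReal.ofReal (s ^ (r - 1) * Real.Gamma (1 - r)) ∂μ := by
                congr 1
                refine lintegral_congr_ae ?_
                filter_upwards [hpos] with y hy
                exact lintegral_rpow_exp hr1 hs' hy
            _ = ENNReal.ofReal (Real.exp (-s ^ r) * (r * s ^ (r - 1))) := by
                rw [lintegral_mul_const' _ _ ENNReal.ofReal_ne_top, hL s hs',
                  ← ENNReal.ofReal_mul (Real.exp_pos _).le, ← ENNReal.ofReal_mul (by positivity)]
                congr 1
                field_simp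
      _ = ENNReal.ofReal (Real.exp (-t ^ r)) := lintegral_deriv_exp hr0 ht
  have hfinite : ∀ᵐ x ∂(volume.restrict (Ioi (0 : ℝ))), F x < ⊤ := by
    refine ae_lt_top hF ?_
    have := key 0 le_rfl
    simp only [zero_mul, neg_zero, Real.exp_zero, ENNReal.ofReal_one, one_mul] at this
    rw [this]
    exact ENNReal.ofReal_ne_top
  refine ⟨fun x => (F x).toReal, hF.ennreal_toReal, fun x => ENNReal.toReal_nonneg,
    fun x hx => ?_, fun t ht => ?_⟩
  · simp [F, ENNReal.ofReal_of_nonpos (inv_nonpos.2 hx)]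
  rw [← key t ht]
  refine lintegral_congr_ae ?_
  filter_upwards [hfinite] with x hx
  rw [ENNReal.ofReal_mul (Real.exp_pos _).le, ENNReal.ofReal_toReal hx.ne]

/-- The density `f_r` of the fully right-skewed `r`-stable distribution, `0 < r < 1`. It is unique
up to a Lebesgue null set; one version is fixed here (and `0` is used for other values of `r`). -/
noncomputable def stableDensity (r : ℝ) : ℝ → ℝ :=
  open Classical in
  if h : 0 < r ∧ r < 1 then (exists_isStableDensity h.1 h.2).choose else 0

theorem stableDensity_spec {r : ℝ} (hr0 : 0 < r) (hr1 : r < 1) :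
    IsStableDensity r (stableDensity r) := by
  unfold stableDensity
  rw [dif_pos ⟨hr0, hr1⟩]
  exact (exists_isStableDensity hr0 hr1).choose_spec

/-- A Lévy measure on `ℝ^d`: a Borel measure with `M {0} = 0` and `∫ (|x|² ∧ 1) M(dx) < ∞`. -/
structure IsLevyMeasure {d : ℕ} (M : Measure (EuclideanSpace ℝ (Fin d))) : Prop where
  measure_zero : M {0} = 0
  lintegral_lt_top : ∫⁻ x, ENNReal.ofReal (min (‖x‖ ^ 2) 1) ∂M < ⊤

/-- The upsilon transform with dilation measure `ρ` (a measure on `(0, ∞)`): the mixture over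
`ρ(ds)` of the images of `M` under the dilations `x ↦ s x`, that is,
`B ↦ ∫_0^∞ M(s⁻¹ B) ρ(ds)`; see `upsilon_apply`. -/
noncomputable def upsilon {d : ℕ} (ρ : Measure ℝ) (M : Measure (EuclideanSpace ℝ (Fin d))) :
    Measure (EuclideanSpace ℝ (Fin d)) :=
  (ρ.restrict (Ioi 0)).bind fun s => M.map fun x => s • x

/-- The domain of an upsilon transform: the Lévy measures whose transform is a Lévy measure. -/
def upsilonDomain (d : ℕ) (ρ : Measure ℝ) : Set (Measure (EuclideanSpace ℝ (Fin d))) :=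
  {M | IsLevyMeasure M ∧ IsLevyMeasure (upsilon ρ M)}

/-- The normalizing constant `K_{α,β,p} = ∫_0^∞ u^(α-β-1) exp(-u^p) du`. -/
noncomputable def normConst (α β p : ℝ) : ℝ :=
  ∫ u in Ioi (0 : ℝ), u ^ (α - β - 1) * Real.exp (-u ^ p)

/-- The dilation measure
`τ_{β→α,p}(ds) = K_{α,β,p}⁻¹ s^(-α-1) (1 - s^p)^((α-β)/p-1) 1_{0<s<1} ds`. -/
noncomputable def tau (β α p : ℝ) : Measure ℝ :=
  (volume.restrict (Ioo 0 1)).withDensity fun s =>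
    ENNReal.ofReal (1 / normConst α β p * s ^ (-α - 1) * (1 - s ^ p) ^ ((α - β) / p - 1))

/-- The dilation measure `π_{α,p→q}(ds) = p f_{q/p}(s^(-p)) s^(-α-p-1) 1_{s>0} ds`. -/
noncomputable def dilationPi (α p q : ℝ) : Measure ℝ :=
  (volume.restrict (Ioi 0)).withDensity fun s =>
    ENNReal.ofReal (p * stableDensity (q / p) (s ^ (-p)) * s ^ (-α - p - 1))

/-- The transform `T_{β→α,p}`. -/
noncomputable def transformT (d : ℕ) (β α p : ℝ) :
    Measure (EuclideanSpace ℝ (Fin d)) → Measure (EuclideanSpace ℝ (Fin d)) :=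
  upsilon (tau β α p)

/-- The transform `P_{α,p→q}`. -/
noncomputable def transformP (d : ℕ) (α p q : ℝ) :
    Measure (EuclideanSpace ℝ (Fin d)) → Measure (EuclideanSpace ℝ (Fin d)) :=
  upsilon (dilationPi α p q)

/-- The formula for the upsilon transform of an s-finite measure (in particular of a σ-finite
one); the preimage of `B` under `x ↦ s x` is `s⁻¹ B`. -/
theorem upsilon_apply {d : ℕ} (ρ : Measure ℝ) (M : Measure (EuclideanSpace ℝ (Fin d))) [SFinite M]
    {B : Set (EuclideanSpace ℝ (Fin d))} (hB : MeasurableSet B) :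
    upsilon ρ M B = ∫⁻ s in Ioi (0 : ℝ), M ((fun x => s • x) ⁻¹' B) ∂ρ := by
  have hmeas : Measurable fun s : ℝ => M.map fun x => s • x := by
    refine Measure.measurable_of_measurable_coe _ fun A hA => ?_
    have : ∀ s : ℝ, (M.map fun x => s • x) A = M (Prod.mk s ⁻¹' {p | p.1 • p.2 ∈ A}) := by
      intro s
      rw [Measure.map_apply (by fun_prop) hA]; rfl
    simp_rw [this]
    exact measurable_measure_prodMk_left
      ((by fun_prop : Measurable fun p : ℝ × EuclideanSpace ℝ (Fin d) => p.1 • p.2) hA)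
  rw [upsilon, Measure.bind_apply hB hmeas.aemeasurable]
  exact lintegral_congr fun s => Measure.map_apply (by fun_prop) hB

/-- Every Lévy measure is σ-finite. -/
theorem IsLevyMeasure.sigmaFinite {d : ℕ} {M : Measure (EuclideanSpace ℝ (Fin d))}
    (hM : IsLevyMeasure M) : SigmaFinite M := by
  refine ⟨⟨⟨fun n => {0} ∪ {x | ENNReal.ofReal (n + 1 : ℝ)⁻¹ ≤
    ENNReal.ofReal (min (‖x‖ ^ 2) 1)}, fun _ => trivial, fun n => ?_, ?_⟩⟩⟩
  · refine (measure_union_le _ _).trans_lt ?_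
    rw [hM.measure_zero, zero_add]
    refine (meas_ge_le_lintegral_div (by fun_prop) ?_ ENNReal.ofReal_ne_top).trans_lt ?_
    · simp only [ne_eq, ENNReal.ofReal_eq_zero, not_le]; positivity
    · refine ENNReal.div_lt_top hM.lintegral_lt_top.ne ?_
      simp only [ne_eq, ENNReal.ofReal_eq_zero, not_le]; positivity
  · refine eq_univ_of_forall fun x => mem_iUnion.2 ?_
    by_cases hx : x = 0
    · exact ⟨0, Or.inl hx⟩
    · have h : 0 < min (‖x‖ ^ 2) 1 := lt_min (by positivity) one_pos
      obtain ⟨n, hn⟩ := exists_nat_one_div_lt h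
      refine ⟨n, Or.inr (ENNReal.ofReal_le_ofReal ?_)⟩
      rw [← one_div]; exact hn.le

end UpsilonTransform

namespace UpsilonTransform

open MeasureTheory Set Filter Topology ProbabilityTheory

/-! By Tonelli, integrating `g` against the transform of `M` is integrating the dual function `x ↦ ∫
g (s x) ρ(ds)` against `M`. Both duals act explicitly on the weights `‖x‖ ^ α * exp (-(θ * ‖x‖ ^
(-p)))`: that of `τ` raises the exponent from `β` to `α` up to a constant (a Gamma integral,
`setLIntegral_tau_radialWeight`), and that of `π` replaces `p` by `q` and `θ` by `θ ^ (q / p)` (the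
stable Laplace transform, `setLIntegral_dilationPi_radialWeight`).

Positive dilations preserve cones, so equal transforms force `M` and `M'` to give each such weight
the same integral over every measurable cone. As a function of `θ` this integral is a Laplace
transform in the variable `‖x‖ ^ (-p)`. Where it is finite, its uniqueness, applied to cones of
directions, identifies the measures in polar coordinates (`ext_of_setLIntegral_radialWeight`).

Finiteness near `0` is automatic, since the exponential beats every power. Away from `0` a moment of
order `α` is needed: it is trivial for `α < 0`, and for `τ` it is forced by membership in the domain
(`exists_const_mul_rpow_le_tau`). -/

/-! ### Uniqueness of Laplace transforms. -/

/-- Two finite measures on the line whose moment generating functions are finite and agree on a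
neighbourhood of `0` are equal. -/
theorem ext_of_mgf_eqOn {μ ν : Measure ℝ} [IsFiniteMeasure μ] [IsFiniteMeasure ν] {a b : ℝ}
    (ha : a < 0) (hb : 0 < b) (hμ : Ioo a b ⊆ integrableExpSet id μ)
    (hν : Ioo a b ⊆ integrableExpSet id ν) (h : EqOn (mgf id μ) (mgf id ν) (Ioo a b)) : μ = ν := by
  have hμ' := interior_maximal hμ isOpen_Ioo
  have hν' := interior_maximal hν isOpen_Ioo
  have hA : AnalyticOnNhd ℂ (complexMGF id μ) {z | z.re ∈ Ioo a b} :=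
    fun z hz => analyticOnNhd_complexMGF z (hμ' hz)
  have hB : AnalyticOnNhd ℂ (complexMGF id ν) {z | z.re ∈ Ioo a b} :=
    fun z hz => analyticOnNhd_complexMGF z (hν' hz)
  have hconn : IsPreconnected {z : ℂ | z.re ∈ Ioo a b} :=
    ((convex_Ioo a b).linear_preimage Complex.reLm).isPreconnected
  have hreal : ∀ᶠ x : ℝ in 𝓝[≠] 0, complexMGF id μ x = complexMGF id ν x := by
    filter_upwards [mem_nhdsWithin_of_mem_nhds (Ioo_mem_nhds ha hb)] with x hx
    rw [complexMGF_ofReal, complexMGF_ofReal, h hx]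
  have ht : Tendsto (fun x : ℝ => (x : ℂ)) (𝓝[≠] 0) (𝓝[≠] 0) := by
    refine tendsto_nhdsWithin_iff.2 ⟨?_, ?_⟩
    · exact (Complex.continuous_ofReal.tendsto' 0 0 (by simp)).mono_left nhdsWithin_le_nhds
    · filter_upwards [self_mem_nhdsWithin] with x hx
      simpa using hx
  -- Identity theorem on the vertical strip: agreement at real points accumulating at `0` spreads to
  -- the imaginary axis, where the complex moment generating function is the characteristic
  -- function.
  have key := hA.eqOn_of_preconnected_of_frequently_eq hB hconn (z₀ := 0) (by simp [ha, hb])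
    (ht.frequently hreal.frequently)
  refine Measure.ext_of_charFun (funext fun t => ?_)
  rw [← complexMGF_id_mul_I, ← complexMGF_id_mul_I]
  exact key (by simp [ha, hb])

/-- Two measures on the line whose Laplace transforms are finite and agree on `(-1, ∞)` are
equal. -/
theorem ext_of_lintegral_exp_eq {μ ν : Measure ℝ}
    (hfin : ∀ t : ℝ, -1 < t → ∫⁻ x, ENNReal.ofReal (Real.exp (-(t * x))) ∂μ ≠ ⊤)
    (h : ∀ t : ℝ, -1 < t → ∫⁻ x, ENNReal.ofReal (Real.exp (-(t * x))) ∂μ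
      = ∫⁻ x, ENNReal.ofReal (Real.exp (-(t * x))) ∂ν) : μ = ν := by
  have hfin' : ∀ t : ℝ, -1 < t → ∫⁻ x, ENNReal.ofReal (Real.exp (-(t * x))) ∂ν ≠ ⊤ :=
    fun t ht => h t ht ▸ hfin t ht
  have hfinite : ∀ ρ : Measure ℝ,
      (∀ t : ℝ, -1 < t → ∫⁻ x, ENNReal.ofReal (Real.exp (-(t * x))) ∂ρ ≠ ⊤) →
      IsFiniteMeasure ρ ∧ Ioo (-1) 1 ⊆ integrableExpSet id ρ := by
    intro ρ hρ
    refine ⟨⟨?_⟩, fun t ht => ?_⟩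
    · have := hρ 0 (by norm_num)
      simpa [lt_top_iff_ne_top] using this
    · have h1 := hρ (-t) (by linarith [ht.2])
      refine ⟨by fun_prop, ?_⟩
      rw [hasFiniteIntegral_iff_ofReal (Eventually.of_forall fun _ => (Real.exp_pos _).le)]
      simpa [lt_top_iff_ne_top] using h1
  obtain ⟨_, hμ⟩ := hfinite μ hfin
  obtain ⟨_, hν⟩ := hfinite ν hfin'
  refine ext_of_mgf_eqOn (by norm_num) one_pos hμ hν fun t ht => ?_
  have h1 := h (-t) (by linarith [ht.2])
  rw [mgf, mgf, integral_eq_lintegral_of_nonneg_ae (Eventually.of_forall fun _ =>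
    (Real.exp_pos _).le) (by fun_prop), integral_eq_lintegral_of_nonneg_ae
    (Eventually.of_forall fun _ => (Real.exp_pos _).le) (by fun_prop)]
  congr 1
  simpa using h1

/-! ### Cones, radial weights and polar coordinates. -/

variable {d : ℕ}

/-- A measurable cone: a Borel set that is invariant under the dilations by positive scalars. -/
structure IsMeasurableCone (A : Set (EuclideanSpace ℝ (Fin d))) : Prop where
  measurableSet : MeasurableSet A
  smul_mem_iff : ∀ s : ℝ, 0 < s → ∀ x, s • x ∈ A ↔ x ∈ A

theorem isMeasurableCone_direction_preimage {S : Set (EuclideanSpace ℝ (Fin d))}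
    (hS : MeasurableSet S) : IsMeasurableCone ((fun x => ‖x‖⁻¹ • x) ⁻¹' S) := by
  refine ⟨(by fun_prop : Measurable fun x : EuclideanSpace ℝ (Fin d) => ‖x‖⁻¹ • x) hS,
    fun s hs x => ?_⟩
  have : ‖s • x‖⁻¹ • s • x = ‖x‖⁻¹ • x := by
    rw [norm_smul, Real.norm_of_nonneg hs.le, smul_smul, mul_inv, mul_right_comm,
      inv_mul_cancel₀ hs.ne', one_mul]
  simp only [mem_preimage, this]

/-- The weight `‖x‖ ^ α * exp (-(θ * ‖x‖ ^ (-p)))`. -/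
noncomputable def radialWeight (α p θ : ℝ) (x : EuclideanSpace ℝ (Fin d)) : ENNReal :=
  ENNReal.ofReal (‖x‖ ^ α * Real.exp (-(θ * ‖x‖ ^ (-p))))

theorem measurable_radialWeight (α p θ : ℝ) :
    Measurable (radialWeight α p θ : EuclideanSpace ℝ (Fin d) → ENNReal) := by
  unfold radialWeight; fun_prop

/-- A measure without an atom at `0` is determined by the integrals of the radial weights over
measurable cones. -/
theorem ext_of_setLIntegral_radialWeight {M N : Measure (EuclideanSpace ℝ (Fin d))} {α p : ℝ}
    (hp : 0 < p) (hM0 : M {0} = 0) (hN0 : N {0} = 0)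
    (hfin : ∀ θ : ℝ, 0 < θ → ∫⁻ x, radialWeight α p θ x ∂M ≠ ⊤)
    (h : ∀ θ : ℝ, 0 < θ → ∀ A, IsMeasurableCone A →
      ∫⁻ x in A, radialWeight α p θ x ∂M = ∫⁻ x in A, radialWeight α p θ x ∂N) : M = N := by
  -- Tilting by the weight with `θ = 1` makes the measures finite; the remaining parameter `t = θ -
  -- 1` ranges over `(-1, ∞)`, which contains a neighbourhood of `0`.
  set w : EuclideanSpace ℝ (Fin d) → ENNReal := radialWeight α p 1 with hw
  have hwm : Measurable w := measurable_radialWeight α p 1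
  -- Polar coordinates with `‖x‖ ^ (-p)` as radial variable; `Ψ` inverts `Φ` off the origin, which
  -- is a null set.
  let Φ : EuclideanSpace ℝ (Fin d) → EuclideanSpace ℝ (Fin d) × ℝ :=
    fun x => (‖x‖⁻¹ • x, ‖x‖ ^ (-p))
  let Ψ : EuclideanSpace ℝ (Fin d) × ℝ → EuclideanSpace ℝ (Fin d) :=
    fun y => (y.2 ^ (-p⁻¹)) • y.1
  have hΦ : Measurable Φ := by fun_prop
  have hΨ : Measurable Ψ := by fun_prop
  have hinv : ∀ x, x ≠ 0 → Ψ (Φ x) = x := by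
    intro x hx
    have hx' : 0 < ‖x‖ := norm_pos_iff.2 hx
    simp only [Φ, Ψ]
    rw [← Real.rpow_mul hx'.le, neg_mul_neg, mul_inv_cancel₀ hp.ne', Real.rpow_one, smul_smul,
      mul_inv_cancel₀ hx'.ne', one_smul]
  have hae : ∀ ρ : Measure (EuclideanSpace ℝ (Fin d)), ρ {0} = 0 → ∀ᵐ x ∂ρ, x ≠ 0 := by
    intro ρ hρ
    rw [ae_iff]; simpa using hρ
  have hwpos : ∀ x, x ≠ 0 → w x ≠ 0 := by
    intro x hx
    have hx' : 0 < ‖x‖ := norm_pos_iff.2 hx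
    simp only [hw, radialWeight, ne_eq, ENNReal.ofReal_eq_zero, not_le]
    positivity
  have hlap : ∀ (ρ : Measure (EuclideanSpace ℝ (Fin d))) (A : Set (EuclideanSpace ℝ (Fin d))),
      MeasurableSet A → ∀ t : ℝ,
      ∫⁻ r, ENNReal.ofReal (Real.exp (-(t * r)))
        ∂(((ρ.restrict A).withDensity w).map fun x => ‖x‖ ^ (-p))
        = ∫⁻ x in A, radialWeight α p (1 + t) x ∂ρ := by
    intro R A hA t
    rw [lintegral_map (by fun_prop) (by fun_prop), lintegral_withDensity_eq_lintegral_mul _ hwm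
      (by fun_prop)]
    refine lintegral_congr fun x => ?_
    simp only [Pi.mul_apply, hw, radialWeight]
    rw [← ENNReal.ofReal_mul (by positivity), mul_assoc, ← Real.exp_add]
    congr 3
    ring_nf
  have hfinM : IsFiniteMeasure (M.withDensity w) :=
    isFiniteMeasure_withDensity (hfin 1 one_pos)
  have hmap : (M.withDensity w).map Φ = (N.withDensity w).map Φ := by
    -- On a rectangle `S ×ˢ T`, fixing `S` restricts to the cone of directions in `S`, and what
    -- remains is a one-dimensional Laplace uniqueness problem.
    refine Measure.ext_prod fun {S T} hS hT => ?_
    have hA := isMeasurableCone_direction_preimage hS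
    have e : ((M.restrict ((fun x => ‖x‖⁻¹ • x) ⁻¹' S)).withDensity w).map (fun x => ‖x‖ ^ (-p))
        = ((N.restrict ((fun x => ‖x‖⁻¹ • x) ⁻¹' S)).withDensity w).map (fun x => ‖x‖ ^ (-p)) := by
      refine ext_of_lintegral_exp_eq (fun t ht => ?_) fun t ht => ?_
      · rw [hlap _ _ hA.measurableSet]
        exact ne_top_of_le_ne_top (hfin (1 + t) (by linarith)) (setLIntegral_le_lintegral _ _)
      · rw [hlap _ _ hA.measurableSet, hlap _ _ hA.measurableSet]
        exact h (1 + t) (by linarith) _ hA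
    have e' := congrArg (fun ρ : Measure ℝ => ρ T) e
    rw [Measure.map_apply (by fun_prop) hT, Measure.map_apply (by fun_prop) hT,
      ← restrict_withDensity hA.measurableSet, ← restrict_withDensity hA.measurableSet,
      Measure.restrict_apply ((by fun_prop : Measurable _) hT),
      Measure.restrict_apply ((by fun_prop : Measurable _) hT)] at e'
    rw [Measure.map_apply hΦ (hS.prod hT), Measure.map_apply hΦ (hS.prod hT)]
    have hpre : Φ ⁻¹' S ×ˢ T = (fun x => ‖x‖ ^ (-p)) ⁻¹' T ∩ (fun x => ‖x‖⁻¹ • x) ⁻¹' S :=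
      inter_comm _ _
    rw [hpre]
    exact e'
  have hback : ∀ ρ : Measure (EuclideanSpace ℝ (Fin d)), ρ {0} = 0 →
      ((ρ.withDensity w).map Φ).map Ψ = ρ.withDensity w := by
    intro ρ hρ
    rw [Measure.map_map hΨ hΦ]
    have : Ψ ∘ Φ =ᵐ[ρ.withDensity w] id := by
      refine (withDensity_absolutelyContinuous ρ w).ae_le ?_
      filter_upwards [hae ρ hρ] with x hx using hinv x hx
    rw [Measure.map_congr this, Measure.map_id]
  have hW : M.withDensity w = N.withDensity w := by
    rw [← hback M hM0, ← hback N hN0, hmap]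
  have hrec : ∀ ρ : Measure (EuclideanSpace ℝ (Fin d)), ρ {0} = 0 →
      (ρ.withDensity w).withDensity (fun x => (w x)⁻¹) = ρ := by
    intro ρ hρ
    refine withDensity_inv_same hwm ?_ (Eventually.of_forall fun x => ENNReal.ofReal_ne_top)
    filter_upwards [hae ρ hρ] with x hx using hwpos x hx
  rw [← hrec M hM0, ← hrec N hN0, hW]

/-! ### Duality. -/

theorem lintegral_upsilon (ρ : Measure ℝ) [SFinite ρ] (M : Measure (EuclideanSpace ℝ (Fin d)))
    [SFinite M] {g : EuclideanSpace ℝ (Fin d) → ENNReal} (hg : Measurable g) :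
    ∫⁻ y, g y ∂(upsilon ρ M) = ∫⁻ x, ∫⁻ s in Ioi (0 : ℝ), g (s • x) ∂ρ ∂M := by
  have hmeas : Measurable fun s : ℝ => M.map fun x => s • x := by
    refine Measure.measurable_of_measurable_coe _ fun A hA => ?_
    have : ∀ s : ℝ, (M.map fun x => s • x) A = M (Prod.mk s ⁻¹' {p | p.1 • p.2 ∈ A}) := by
      intro s
      rw [Measure.map_apply (by fun_prop) hA]; rfl
    simp_rw [this]
    exact measurable_measure_prodMk_left
      ((by fun_prop : Measurable fun p : ℝ × EuclideanSpace ℝ (Fin d) => p.1 • p.2) hA)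
  rw [upsilon, Measure.lintegral_bind hmeas.aemeasurable hg.aemeasurable]
  simp_rw [lintegral_map hg (measurable_const_smul _)]
  exact lintegral_lintegral_swap (by fun_prop)

/-- For `s > 0` the indicator of a cone takes the same value at `s • x` and at `x`, so it leaves the
inner integral of the duality formula. -/
theorem setLIntegral_upsilon (ρ : Measure ℝ) [SFinite ρ] (M : Measure (EuclideanSpace ℝ (Fin d)))
    [SFinite M] {g : EuclideanSpace ℝ (Fin d) → ENNReal} (hg : Measurable g)
    {A : Set (EuclideanSpace ℝ (Fin d))} (hA : IsMeasurableCone A) :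
    ∫⁻ y in A, g y ∂(upsilon ρ M) = ∫⁻ x in A, ∫⁻ s in Ioi (0 : ℝ), g (s • x) ∂ρ ∂M := by
  rw [← lintegral_indicator hA.measurableSet, lintegral_upsilon ρ M (hg.indicator hA.measurableSet),
    ← lintegral_indicator hA.measurableSet]
  refine lintegral_congr fun x => ?_
  by_cases hx : x ∈ A
  · rw [indicator_of_mem hx]
    refine setLIntegral_congr_fun measurableSet_Ioi fun s hs => ?_
    exact indicator_of_mem ((hA.smul_mem_iff s hs x).2 hx) _
  · rw [indicator_of_notMem hx, ← lintegral_zero (μ := ρ.restrict (Ioi 0))]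
    refine setLIntegral_congr_fun measurableSet_Ioi fun s hs => ?_
    exact indicator_of_notMem (fun h => hx ((hA.smul_mem_iff s hs x).1 h)) _

/-! ### Integrability of the radial weights. -/

theorem IsLevyMeasure.ae_ne_zero {M : Measure (EuclideanSpace ℝ (Fin d))} (hM : IsLevyMeasure M) :
    ∀ᵐ x ∂M, x ≠ 0 := by
  rw [ae_iff]; simpa using hM.measure_zero

/-- Markov's inequality for `‖x‖ ^ 2 ∧ 1`, which is at least `ε ^ 2 ∧ 1` on this set. -/
theorem IsLevyMeasure.measure_lt_norm_ne_top {M : Measure (EuclideanSpace ℝ (Fin d))}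
    (hM : IsLevyMeasure M) {ε : ℝ} (hε : 0 < ε) : M {x | ε < ‖x‖} ≠ ⊤ := by
  have h : 0 < min (ε ^ 2) 1 := by positivity
  refine ne_top_of_le_ne_top ?_ (measure_mono (t := {x | ENNReal.ofReal (min (ε ^ 2) 1) ≤
    ENNReal.ofReal (min (‖x‖ ^ 2) 1)}) fun x hx => ?_)
  · refine ((meas_ge_le_lintegral_div (by fun_prop) ?_ ENNReal.ofReal_ne_top).trans_lt
      (ENNReal.div_lt_top hM.lintegral_lt_top.ne ?_)).ne <;>
    simpa using hε.ne'
  · have hx' : ε < ‖x‖ := hx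
    exact ENNReal.ofReal_le_ofReal (min_le_min_right _ (by gcongr))

/-- With `u = r ^ (-p)`, which tends to infinity as `r` decreases to `0`, the quotient of the two
sides is `u ^ ((2 - α) / p) * exp (-θ * u)`, and this tends to `0`. -/
theorem exists_rpow_mul_exp_le_sq (α : ℝ) {p θ : ℝ} (hp : 0 < p) (hθ : 0 < θ) :
    ∃ ε : ℝ, 0 < ε ∧ ε ≤ 1 ∧
      ∀ r : ℝ, 0 < r → r ≤ ε → r ^ α * Real.exp (-(θ * r ^ (-p))) ≤ r ^ 2 := by
  have h1 := (tendsto_rpow_mul_exp_neg_mul_atTop_nhds_zero ((2 - α) / p) θ hθ).comp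
    (tendsto_rpow_neg_nhdsGT_zero (neg_lt_zero.2 hp))
  obtain ⟨δ, hδ, hsub⟩ := mem_nhdsGT_iff_exists_Ioc_subset.1
    (h1.eventually (gt_mem_nhds (zero_lt_one (α := ℝ))))
  refine ⟨min δ 1, lt_min hδ one_pos, min_le_right _ _, fun r hr hrδ => ?_⟩
  have h2 : (r ^ (-p)) ^ ((2 - α) / p) * Real.exp (-θ * r ^ (-p)) < 1 :=
    hsub ⟨hr, hrδ.trans (min_le_left _ _)⟩
  rw [← Real.rpow_mul hr.le, show -p * ((2 - α) / p) = α - 2 by field_simp; ring,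
    Real.rpow_sub hr, neg_mul] at h2
  have h3 : (0 : ℝ) < r ^ 2 := by positivity
  rw [Real.rpow_two, div_mul_eq_mul_div, div_lt_one h3] at h2
  exact h2.le

/-- Outside a small ball the weight is at most `‖x‖ ^ α`; inside it, `‖x‖ ^ 2 ∧ 1` dominates. -/
theorem IsLevyMeasure.lintegral_radialWeight_ne_top {M : Measure (EuclideanSpace ℝ (Fin d))}
    (hM : IsLevyMeasure M) {α p θ : ℝ} (hp : 0 < p) (hθ : 0 < θ)
    (hα : ∀ ε : ℝ, 0 < ε → ∫⁻ x in {x | ε < ‖x‖}, ENNReal.ofReal (‖x‖ ^ α) ∂M ≠ ⊤) :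
    ∫⁻ x, radialWeight α p θ x ∂M ≠ ⊤ := by
  obtain ⟨ε, hε, hε1, h⟩ := exists_rpow_mul_exp_le_sq α hp hθ
  have hS : MeasurableSet {x : EuclideanSpace ℝ (Fin d) | ε < ‖x‖} :=
    measurableSet_lt measurable_const measurable_norm
  rw [← lintegral_add_compl _ hS]
  refine ENNReal.add_ne_top.2 ⟨ne_top_of_le_ne_top (hα ε hε) ?_,
    ne_top_of_le_ne_top hM.lintegral_lt_top.ne
      (le_trans ?_ (setLIntegral_le_lintegral {x | ε < ‖x‖}ᶜ _))⟩
  · refine lintegral_mono fun x => ENNReal.ofReal_le_ofReal ?_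
    refine mul_le_of_le_one_right (by positivity) (Real.exp_le_one_iff.2 ?_)
    have : 0 ≤ θ * ‖x‖ ^ (-p) := by positivity
    linarith
  · refine lintegral_mono_ae ?_
    filter_upwards [ae_restrict_of_ae hM.ae_ne_zero, ae_restrict_mem hS.compl] with x hx hxε
    have hxε' : ‖x‖ ≤ ε := not_lt.1 hxε
    refine ENNReal.ofReal_le_ofReal ((h _ (norm_pos_iff.2 hx) hxε').trans (le_min le_rfl ?_))
    exact pow_le_one₀ (norm_nonneg x) (hxε'.trans hε1)

/-! ### The injectivity criterion. -/

/-- An upsilon transform is one-to-one on its domain as soon as suitable functions are mapped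
to the radial weights by its dual and the measures of its domain have finite moments of order `α`
away from `0`. -/
theorem injOn_upsilonDomain {ρ : Measure ℝ} [SFinite ρ] {α p : ℝ} (hp : 0 < p)
    (hmom : ∀ M ∈ upsilonDomain d ρ, ∀ ε : ℝ, 0 < ε →
      ∫⁻ x in {x | ε < ‖x‖}, ENNReal.ofReal (‖x‖ ^ α) ∂M ≠ ⊤)
    (hdual : ∀ θ : ℝ, 0 < θ → ∃ (g : EuclideanSpace ℝ (Fin d) → ENNReal) (C : ENNReal),
      Measurable g ∧ C ≠ 0 ∧ C ≠ ⊤ ∧ ∀ x, x ≠ 0 →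
        ∫⁻ s in Ioi (0 : ℝ), g (s • x) ∂ρ = C * radialWeight α p θ x) :
    InjOn (upsilon ρ) (upsilonDomain d ρ) := by
  intro M hM N hN hMN
  refine ext_of_setLIntegral_radialWeight (α := α) hp hM.1.measure_zero hN.1.measure_zero
    (fun θ hθ => hM.1.lintegral_radialWeight_ne_top hp hθ (hmom M hM)) fun θ hθ A hA => ?_
  obtain ⟨g, C, hg, hC0, hC, hgC⟩ := hdual θ hθ
  have key : ∀ R : Measure (EuclideanSpace ℝ (Fin d)), IsLevyMeasure R →
      ∫⁻ y in A, g y ∂(upsilon ρ R) = C * ∫⁻ x in A, radialWeight α p θ x ∂(R) := by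
    intro R hR
    have := hR.sigmaFinite
    rw [setLIntegral_upsilon ρ R hg hA, ← lintegral_const_mul _ (measurable_radialWeight α p θ)]
    refine lintegral_congr_ae ?_
    filter_upwards [ae_restrict_of_ae hR.ae_ne_zero] with x hx using hgC x hx
  have h := key M hM.1
  rw [hMN, key N hN.1] at h
  exact ((ENNReal.mul_right_inj hC0 hC).1 h).symm

/-! ### Substitutions and the Gamma integral. -/

theorem hasDerivWithinAt_rpow_neg {p s : ℝ} (hs : 0 < s) (S : Set ℝ) :
    HasDerivWithinAt (fun s : ℝ => s ^ (-p)) (-p * s ^ (-p - 1)) S s :=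
  (Real.hasDerivAt_rpow_const (Or.inl hs.ne')).hasDerivWithinAt

theorem injOn_rpow_neg {p : ℝ} (hp : 0 < p) : InjOn (fun s : ℝ => s ^ (-p)) (Ioi 0) := by
  intro s hs t ht h
  exact (Real.rpow_left_inj (le_of_lt hs) (le_of_lt ht) (neg_ne_zero.2 hp.ne')).1 h

theorem abs_neg_mul_rpow {p s : ℝ} (hp : 0 < p) (hs : 0 < s) :
    |-p * s ^ (-p - 1)| = p * s ^ (-p - 1) := by
  rw [abs_mul, abs_neg, abs_of_pos hp, abs_of_pos (Real.rpow_pos_of_pos hs _)]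

theorem lintegral_Ioi_eq_lintegral_rpow_neg {p : ℝ} (hp : 0 < p) (F : ℝ → ENNReal) :
    ∫⁻ u in Ioi (0 : ℝ), F u
      = ∫⁻ s in Ioi (0 : ℝ), ENNReal.ofReal (p * s ^ (-p - 1)) * F (s ^ (-p)) := by
  have himg : (fun s : ℝ => s ^ (-p)) '' Ioi 0 = Ioi 0 := by
    ext u
    constructor
    · rintro ⟨s, hs, rfl⟩
      exact Real.rpow_pos_of_pos hs _
    · intro hu
      have hu' : (0 : ℝ) < u := hu
      refine ⟨u ^ (-p⁻¹), Real.rpow_pos_of_pos hu' _, ?_⟩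
      simp only
      rw [← Real.rpow_mul hu'.le, neg_mul_neg, inv_mul_cancel₀ hp.ne', Real.rpow_one]
  have h := lintegral_image_eq_lintegral_abs_deriv_mul measurableSet_Ioi
    (fun s hs => hasDerivWithinAt_rpow_neg hs (Ioi 0)) (injOn_rpow_neg hp) F
  rw [himg] at h
  rw [h]
  refine setLIntegral_congr_fun measurableSet_Ioi fun s hs => ?_
  simp only [abs_neg_mul_rpow hp hs]

theorem lintegral_Ioi_eq_lintegral_rpow_neg_sub_one {p : ℝ} (hp : 0 < p) (F : ℝ → ENNReal) :
    ∫⁻ u in Ioi (0 : ℝ), F u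
      = ∫⁻ s in Ioo (0 : ℝ) 1, ENNReal.ofReal (p * s ^ (-p - 1)) * F (s ^ (-p) - 1) := by
  have himg : (fun s : ℝ => s ^ (-p) - 1) '' Ioo 0 1 = Ioi 0 := by
    ext u
    constructor
    · rintro ⟨s, hs, rfl⟩
      exact sub_pos.2 (Real.one_lt_rpow_of_pos_of_lt_one_of_neg hs.1 hs.2 (neg_lt_zero.2 hp))
    · intro hu
      have hu' : (0 : ℝ) < u := hu
      have hu1 : (0 : ℝ) < u + 1 := by linarith
      refine ⟨(u + 1) ^ (-p⁻¹), ⟨Real.rpow_pos_of_pos hu1 _,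
        Real.rpow_lt_one_of_one_lt_of_neg (by linarith) (neg_lt_zero.2 (inv_pos.2 hp))⟩, ?_⟩
      simp only
      rw [← Real.rpow_mul hu1.le, neg_mul_neg, inv_mul_cancel₀ hp.ne', Real.rpow_one,
        add_sub_cancel_right]
  have h := lintegral_image_eq_lintegral_abs_deriv_mul measurableSet_Ioo
    (fun s hs => (hasDerivWithinAt_rpow_neg (p := p) hs.1 (Ioo 0 1)).sub_const 1)
    (fun s hs t ht hst => injOn_rpow_neg hp hs.1 ht.1 (sub_left_injective hst)) F
  rw [himg] at h
  rw [h]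
  refine setLIntegral_congr_fun measurableSet_Ioo fun s hs => ?_
  simp only [abs_neg_mul_rpow hp hs.1]

theorem lintegral_rpow_mul_exp_neg_mul {κ a : ℝ} (hκ : 0 < κ) (ha : 0 < a) :
    ∫⁻ u in Ioi (0 : ℝ), ENNReal.ofReal (u ^ (κ - 1) * Real.exp (-(a * u)))
      = ENNReal.ofReal (a ^ (-κ) * Real.Gamma κ) := by
  -- The unshifted case `y = 0`, with `r = 1 - κ`.
  have h := lintegral_rpow_exp (r := 1 - κ) (y := 0) (by linarith) ha le_rfl
  rw [show 1 - (1 - κ) = κ by ring, show 1 - κ - 1 = -κ by ring, mul_zero, neg_zero, Real.exp_zero,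
    ENNReal.ofReal_one, one_mul] at h
  rw [← h]
  refine setLIntegral_congr_fun measurableSet_Ioi fun u hu => ?_
  simp only [indicator_of_mem hu, sub_zero, neg_sub]
  rw [← ENNReal.ofReal_mul (Real.exp_pos _).le, mul_comm]

/-! ### Action of the dual transforms on radial weights. -/

theorem setLIntegral_tau (β α p : ℝ) {f : ℝ → ENNReal} (hf : Measurable f) :
    ∫⁻ s in Ioi (0 : ℝ), f s ∂(tau β α p) = ∫⁻ s in Ioo (0 : ℝ) 1,
      ENNReal.ofReal (1 / normConst α β p * s ^ (-α - 1) * (1 - s ^ p) ^ ((α - β) / p - 1))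
        * f s := by
  rw [tau, restrict_withDensity measurableSet_Ioi, Measure.restrict_restrict measurableSet_Ioi,
    inter_eq_right.2 Ioo_subset_Ioi_self, lintegral_withDensity_eq_lintegral_mul _ (by fun_prop) hf]
  rfl

theorem setLIntegral_dilationPi (α : ℝ) {p q : ℝ} (hq : 0 < q) (hqp : q < p) {f : ℝ → ENNReal}
    (hf : Measurable f) :
    ∫⁻ s in Ioi (0 : ℝ), f s ∂(dilationPi α p q) = ∫⁻ s in Ioi (0 : ℝ),
      ENNReal.ofReal (p * stableDensity (q / p) (s ^ (-p)) * s ^ (-α - p - 1)) * f s := by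
  have hp := hq.trans hqp
  have hm := (stableDensity_spec (div_pos hq hp) ((div_lt_one hp).2 hqp)).measurable
  rw [dilationPi, restrict_withDensity measurableSet_Ioi,
    Measure.restrict_restrict measurableSet_Ioi, inter_self,
    lintegral_withDensity_eq_lintegral_mul _ (by fun_prop) hf]
  rfl

instance (β α p : ℝ) : SFinite (tau β α p) := by unfold tau; infer_instance

instance (α p q : ℝ) : SFinite (dilationPi α p q) := by unfold dilationPi; infer_instance

theorem normConst_pos {α β p : ℝ} (hβα : β < α) (hp : 0 < p) : 0 < normConst α β p := by
  rw [normConst, integral_rpow_mul_exp_neg_rpow hp (by linarith)]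
  have : 0 < Real.Gamma ((α - β - 1 + 1) / p) :=
    Real.Gamma_pos_of_pos (div_pos (by linarith) hp)
  positivity

/-- Put `u = s ^ (-p) - 1` and `a = θ * ‖x‖ ^ (-p)`. The exponent `θ * ‖s • x‖ ^ (-p)` becomes `a +
a * u`, so `exp (-a)` factors out and a Gamma integral of order `κ = (α - β) / p` remains. Its value
contains `a ^ (-κ)`, which supplies the missing power `‖x‖ ^ (α - β)`. -/
theorem setLIntegral_tau_radialWeight {β α p θ : ℝ} (hβα : β < α) (hp : 0 < p) (hθ : 0 < θ)
    {x : EuclideanSpace ℝ (Fin d)} (hx : x ≠ 0) :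
    ∫⁻ s in Ioi (0 : ℝ), radialWeight β p θ (s • x) ∂(tau β α p)
      = ENNReal.ofReal (θ ^ (-((α - β) / p)) * Real.Gamma ((α - β) / p) / (normConst α β p * p))
        * radialWeight α p θ x := by
  have hK := normConst_pos hβα hp
  set K := normConst α β p with hKdef
  have hr : 0 < ‖x‖ := norm_pos_iff.2 hx
  set r := ‖x‖ with hrdef
  set κ := (α - β) / p with hκdef
  have hκ : 0 < κ := div_pos (by linarith) hp
  have hpκ : p * κ = α - β := by rw [hκdef]; field_simp
  have hΓ : 0 < Real.Gamma κ := Real.Gamma_pos_of_pos hκ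
  set a := θ * r ^ (-p) with hadef
  have ha : 0 < a := by positivity
  rw [setLIntegral_tau β α p (f := fun s => radialWeight β p θ (s • x))
    ((measurable_radialWeight β p θ).comp (by fun_prop))]
  calc _ = ∫⁻ s in Ioo (0 : ℝ) 1, ENNReal.ofReal (1 / (K * p) * (r ^ β * Real.exp (-a))) *
          (ENNReal.ofReal (p * s ^ (-p - 1)) * (fun u =>
            ENNReal.ofReal (u ^ (κ - 1) * Real.exp (-(a * u)))) (s ^ (-p) - 1)) := by
        refine setLIntegral_congr_fun measurableSet_Ioo fun s hs => ?_
        have hs0 : 0 < s := hs.1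
        have hsp : 0 < 1 - s ^ p := sub_pos.2 (Real.rpow_lt_one hs0.le hs.2 hp)
        have e1 : s ^ (-p) - 1 = s ^ (-p) * (1 - s ^ p) := by
          rw [mul_sub, ← Real.rpow_add hs0]; simp
        have e2 : (s ^ (-p) - 1) ^ (κ - 1) = s ^ (-p * (κ - 1)) * (1 - s ^ p) ^ (κ - 1) := by
          rw [e1, Real.mul_rpow (by positivity) hsp.le, ← Real.rpow_mul hs0.le]
        have e3 : θ * (s * r) ^ (-p) = a + a * (s ^ (-p) - 1) := by
          rw [Real.mul_rpow hs0.le hr.le, hadef]; ring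
        have e4 : s ^ (-α - 1) * s ^ β = s ^ (-p - 1) * s ^ (-p * (κ - 1)) := by
          rw [← Real.rpow_add hs0, ← Real.rpow_add hs0]
          congr 1; linear_combination hpκ
        have hpos : 0 ≤ s ^ (-p) - 1 := by rw [e1]; positivity
        simp only [radialWeight]
        rw [norm_smul, Real.norm_of_nonneg hs0.le, ← hrdef, e3,
          ← ENNReal.ofReal_mul (by positivity), ← ENNReal.ofReal_mul (by positivity),
          ← ENNReal.ofReal_mul (by positivity), e2, neg_add, Real.exp_add,
          Real.mul_rpow hs0.le hr.le]
        congr 1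
        calc _ = 1 / K * (1 - s ^ p) ^ (κ - 1) * (s ^ (-α - 1) * s ^ β) * r ^ β * (Real.exp (-a) *
              Real.exp (-(a * (s ^ (-p) - 1)))) := by ring
          _ = _ := by rw [e4]; field_simp
    _ = ENNReal.ofReal (1 / (K * p) * (r ^ β * Real.exp (-a))) *
          ENNReal.ofReal (a ^ (-κ) * Real.Gamma κ) := by
        rw [lintegral_const_mul' _ _ ENNReal.ofReal_ne_top]
        exact congrArg _ ((lintegral_Ioi_eq_lintegral_rpow_neg_sub_one hp _).symm.trans
          (lintegral_rpow_mul_exp_neg_mul hκ ha))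
    _ = _ := by
        have e5 : r ^ β * a ^ (-κ) = θ ^ (-κ) * r ^ α := by
          rw [hadef, Real.mul_rpow hθ.le (by positivity), ← Real.rpow_mul hr.le, mul_left_comm,
            ← Real.rpow_add hr, neg_mul_neg, hpκ, add_sub_cancel]
        rw [radialWeight, ← ENNReal.ofReal_mul (by positivity), ← ENNReal.ofReal_mul (by positivity)]
        congr 1
        calc _ = 1 / (K * p) * Real.exp (-a) * Real.Gamma κ * (r ^ β * a ^ (-κ)) := by ring
          _ = _ := by rw [e5]; ring

/-- After `u = s ^ (-p)` the powers of `s` reduce to the Jacobian, leaving the Laplace transform of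
the stable density at `a = θ * ‖x‖ ^ (-p)`; and `a ^ (q / p) = θ ^ (q / p) * ‖x‖ ^ (-q)`. -/
theorem setLIntegral_dilationPi_radialWeight {α p q θ : ℝ} (hq : 0 < q) (hqp : q < p) (hθ : 0 < θ)
    {x : EuclideanSpace ℝ (Fin d)} (hx : x ≠ 0) :
    ∫⁻ s in Ioi (0 : ℝ), radialWeight α p θ (s • x) ∂(dilationPi α p q)
      = radialWeight α q (θ ^ (q / p)) x := by
  have hp := hq.trans hqp
  have hf := stableDensity_spec (div_pos hq hp) ((div_lt_one hp).2 hqp)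
  set f := stableDensity (q / p) with hfdef
  have hr : 0 < ‖x‖ := norm_pos_iff.2 hx
  set r := ‖x‖ with hrdef
  set a := θ * r ^ (-p) with hadef
  have ha : 0 < a := by positivity
  rw [setLIntegral_dilationPi α hq hqp (f := fun s => radialWeight α p θ (s • x))
    ((measurable_radialWeight α p θ).comp (by fun_prop))]
  calc _ = ∫⁻ s in Ioi (0 : ℝ), ENNReal.ofReal (r ^ α) * (ENNReal.ofReal (p * s ^ (-p - 1)) *
          (fun u => ENNReal.ofReal (Real.exp (-(a * u)) * f u)) (s ^ (-p))) := by
        refine setLIntegral_congr_fun measurableSet_Ioi fun s hs => ?_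
        have hs0 : 0 < s := hs
        have hfs := hf.nonneg (s ^ (-p))
        have e3 : θ * (s * r) ^ (-p) = a * s ^ (-p) := by
          rw [Real.mul_rpow hs0.le hr.le, hadef]; ring
        have e4 : s ^ (-α - p - 1) * s ^ α = s ^ (-p - 1) := by
          rw [← Real.rpow_add hs0]; congr 1; ring
        simp only [radialWeight]
        rw [norm_smul, Real.norm_of_nonneg hs0.le, ← hrdef, e3,
          ← ENNReal.ofReal_mul (by positivity), ← ENNReal.ofReal_mul (by positivity),
          ← ENNReal.ofReal_mul (by positivity), Real.mul_rpow hs0.le hr.le, ← e4]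
        congr 1
        ring
    _ = ENNReal.ofReal (r ^ α) * ENNReal.ofReal (Real.exp (-a ^ (q / p))) := by
        rw [lintegral_const_mul' _ _ ENNReal.ofReal_ne_top]
        exact congrArg _ ((lintegral_Ioi_eq_lintegral_rpow_neg hp _).symm.trans
          (hf.laplace a ha.le))
    _ = _ := by
        rw [radialWeight, ← ENNReal.ofReal_mul (by positivity), hadef,
          Real.mul_rpow hθ.le (by positivity), ← Real.rpow_mul hr.le, neg_mul,
          mul_div_cancel₀ q hp.ne']

/-! ### Moments away from the origin. -/

/-- A real power is monotone or antitone on the positive axis according to the sign of its exponent;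
the minimum covers both cases, as the exponents in `τ` may have either sign. -/
theorem min_rpow_le_rpow {a b y : ℝ} (ha : 0 < a) (hay : a ≤ y) (hyb : y ≤ b) (γ : ℝ) :
    min (a ^ γ) (b ^ γ) ≤ y ^ γ := by
  rcases le_total 0 γ with hγ | hγ
  · exact (min_le_left _ _).trans (Real.rpow_le_rpow ha.le hay hγ)
  · exact (min_le_right _ _).trans (Real.rpow_le_rpow_of_nonpos (ha.trans_le hay) hyb hγ)

/-- The dilation measure `τ` gives mass at least of order `r ^ α` to the dilations that move a
point of norm `r` out of a fixed ball. -/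
theorem exists_const_mul_rpow_le_tau {β α p : ℝ} (hβα : β < α) (hp : 0 < p) {ε : ℝ} (hε : 0 < ε) :
    ∃ c : ℝ, 0 < c ∧ ∀ x : EuclideanSpace ℝ (Fin d), ε < ‖x‖ →
      ENNReal.ofReal (c * ‖x‖ ^ α) ≤ ∫⁻ s in Ioi (0 : ℝ),
        {y : EuclideanSpace ℝ (Fin d) | ε / 4 < ‖y‖}.indicator 1 (s • x) ∂(tau β α p) := by
  have hK := normConst_pos hβα hp
  set K := normConst α β p with hKdef
  set κ := (α - β) / p with hκdef
  have h2p : 0 < 1 - (1 / 2 : ℝ) ^ p :=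
    sub_pos.2 (Real.rpow_lt_one (by norm_num) (by norm_num) hp)
  -- `m₁` bounds `(s / b) ^ (-α - 1)` from below for `s / b` in `[1, 2]`; `m₂` does so for `(1 - s ^
  -- p) ^ (κ - 1)` when `0 < s < 1 / 2`.
  set m₁ : ℝ := min (1 ^ (-α - 1)) (2 ^ (-α - 1)) with hm₁
  set m₂ : ℝ := min ((1 - (1 / 2 : ℝ) ^ p) ^ (κ - 1)) (1 ^ (κ - 1)) with hm₂
  have hm₁0 : 0 < m₁ := lt_min (by positivity) (by positivity)
  have hm₂0 : 0 < m₂ := lt_min (by positivity) (by positivity)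
  refine ⟨1 / K * m₁ * m₂ * (ε / 4) ^ (-α), by positivity, fun x hx => ?_⟩
  have hr : 0 < ‖x‖ := hε.trans hx
  set r := ‖x‖ with hrdef
  -- The dilations `s > b` are those that move `x` out of the ball of radius `ε / 4`. As `r > ε`,
  -- the window `(b, 2b)` stays below `1 / 2`, away from the possible singularity of `τ` at `1`; its
  -- length `b` times `b ^ (-α - 1)` gives the order `r ^ α`.
  set b := ε / 4 / r with hbdef
  have hb : 0 < b := by positivity
  have hb2 : 2 * b < 1 / 2 := by
    rw [hbdef, ← mul_div_assoc, div_lt_iff₀ hr]; linarith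
  have hmeas : MeasurableSet {y : EuclideanSpace ℝ (Fin d) | ε / 4 < ‖y‖} :=
    measurableSet_lt measurable_const measurable_norm
  rw [setLIntegral_tau β α p
    (f := fun s => {y : EuclideanSpace ℝ (Fin d) | ε / 4 < ‖y‖}.indicator 1 (s • x))
    ((measurable_one.indicator hmeas).comp (by fun_prop))]
  have hsub : Ioo b (2 * b) ⊆ Ioo 0 1 := fun s hs => ⟨hb.trans hs.1, by linarith [hs.2]⟩
  refine le_trans ?_ (lintegral_mono_set hsub)
  calc _ = ∫⁻ _ in Ioo b (2 * b), ENNReal.ofReal (1 / K * (b ^ (-α - 1) * m₁) * m₂) := by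
        rw [setLIntegral_const, Real.volume_Ioo, ← ENNReal.ofReal_mul (by positivity)]
        congr 1
        have e1 : b ^ (-α - 1) * b = (ε / 4) ^ (-α) * r ^ α := by
          rw [← Real.rpow_add_one hb.ne', sub_add_cancel, hbdef,
            Real.div_rpow (by positivity) hr.le, Real.rpow_neg hr.le, div_inv_eq_mul]
        linear_combination -(1 / K * m₁ * m₂) * e1
    _ ≤ _ := by
        refine setLIntegral_mono' measurableSet_Ioo fun s hs => ?_
        have hs0 : 0 < s := hb.trans hs.1
        have hmem : s • x ∈ {y : EuclideanSpace ℝ (Fin d) | ε / 4 < ‖y‖} := by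
          rw [mem_ofPred_eq, norm_smul, Real.norm_of_nonneg hs0.le, ← hrdef]
          exact (div_lt_iff₀ hr).1 hs.1
        rw [indicator_of_mem hmem, Pi.one_apply, mul_one]
        refine ENNReal.ofReal_le_ofReal ?_
        have h1 : b ^ (-α - 1) * m₁ ≤ s ^ (-α - 1) := by
          have := min_rpow_le_rpow one_pos ((one_le_div hb).2 hs.1.le)
            ((div_le_iff₀ hb).2 hs.2.le) (-α - 1)
          calc _ ≤ b ^ (-α - 1) * (s / b) ^ (-α - 1) := by gcongr
            _ = s ^ (-α - 1) := by
              rw [← Real.mul_rpow hb.le (by positivity), mul_div_cancel₀ s hb.ne']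
        have h2 : m₂ ≤ (1 - s ^ p) ^ (κ - 1) := by
          refine min_rpow_le_rpow h2p ?_ ?_ _
          · have : s ^ p ≤ (1 / 2) ^ p := Real.rpow_le_rpow hs0.le (by linarith [hs.2]) hp.le
            linarith
          · linarith [Real.rpow_nonneg hs0.le p]
        gcongr

/-- The transform is a Lévy measure, so its mass outside the ball of radius `ε / 4` is finite. By
duality this mass integrates against `M` a function that dominates a multiple of `‖x‖ ^ α` where `ε
< ‖x‖`. -/
theorem setLIntegral_norm_rpow_ne_top_of_mem_upsilonDomain_tau {β α p : ℝ} (hβα : β < α)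
    (hp : 0 < p) {M : Measure (EuclideanSpace ℝ (Fin d))} (hM : M ∈ upsilonDomain d (tau β α p))
    {ε : ℝ} (hε : 0 < ε) : ∫⁻ x in {x | ε < ‖x‖}, ENNReal.ofReal (‖x‖ ^ α) ∂M ≠ ⊤ := by
  have hmeas : ∀ ε : ℝ, MeasurableSet {y : EuclideanSpace ℝ (Fin d) | ε < ‖y‖} :=
    fun ε => measurableSet_lt measurable_const measurable_norm
  obtain ⟨c, hc, h⟩ := exists_const_mul_rpow_le_tau (d := d) hβα hp hε
  have := hM.1.sigmaFinite
  have hN := hM.2.measure_lt_norm_ne_top (ε := ε / 4) (by positivity)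
  rw [← lintegral_indicator_one (hmeas _), lintegral_upsilon _ _
    (measurable_one.indicator (hmeas _))] at hN
  have hle : ENNReal.ofReal c * ∫⁻ x in {x | ε < ‖x‖}, ENNReal.ofReal (‖x‖ ^ α) ∂M ≠ ⊤ := by
    rw [← lintegral_const_mul' _ _ ENNReal.ofReal_ne_top]
    refine ne_top_of_le_ne_top hN (le_trans ?_ (setLIntegral_le_lintegral {x | ε < ‖x‖} _))
    refine setLIntegral_mono' (hmeas ε) fun x hx => ?_
    rw [← ENNReal.ofReal_mul hc.le]
    exact h x hx
  exact fun htop => hle (by rw [htop, ENNReal.mul_top (by simpa using hc)])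

theorem IsLevyMeasure.setLIntegral_norm_rpow_ne_top_of_neg
    {M : Measure (EuclideanSpace ℝ (Fin d))} (hM : IsLevyMeasure M) {α : ℝ} (hα : α < 0)
    {ε : ℝ} (hε : 0 < ε) : ∫⁻ x in {x | ε < ‖x‖}, ENNReal.ofReal (‖x‖ ^ α) ∂M ≠ ⊤ := by
  refine ne_top_of_le_ne_top
    (ENNReal.mul_ne_top (ENNReal.ofReal_ne_top (r := ε ^ α)) (hM.measure_lt_norm_ne_top hε)) ?_
  rw [← setLIntegral_const]
  refine setLIntegral_mono' (measurableSet_lt measurable_const measurable_norm) fun x hx => ?_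
  exact ENNReal.ofReal_le_ofReal (Real.rpow_le_rpow_of_nonpos hε (le_of_lt hx) hα.le)

end UpsilonTransform

/-! ### The two transforms. -/

theorem corollary5 (d : ℕ) :
    (∀ β α p : ℝ, β < α → α < 2 → 0 < p →
      Set.InjOn (UpsilonTransform.transformT d β α p)
        (UpsilonTransform.upsilonDomain d (UpsilonTransform.tau β α p))) ∧
    (∀ α p q : ℝ, 0 < q → q < p → α < 0 →
      Set.InjOn (UpsilonTransform.transformP d α p q)
        (UpsilonTransform.upsilonDomain d (UpsilonTransform.dilationPi α p q))) := by
  open UpsilonTransform in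
  refine ⟨fun β α p hβα _ hp => ?_, fun α p q hq hqp hα => ?_⟩
  · refine injOn_upsilonDomain hp (fun M hM ε hε =>
      setLIntegral_norm_rpow_ne_top_of_mem_upsilonDomain_tau hβα hp hM hε) fun θ hθ =>
      ⟨radialWeight β p θ, _, measurable_radialWeight β p θ, ?_, ENNReal.ofReal_ne_top,
        fun x hx => setLIntegral_tau_radialWeight hβα hp hθ hx⟩
    have hK := normConst_pos hβα hp
    have hΓ : 0 < Real.Gamma ((α - β) / p) :=
      Real.Gamma_pos_of_pos (div_pos (sub_pos.2 hβα) hp)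
    rw [ne_eq, ENNReal.ofReal_eq_zero, not_le]
    positivity
  · have hp := hq.trans hqp
    refine injOn_upsilonDomain hq (fun M hM ε hε =>
      hM.1.setLIntegral_norm_rpow_ne_top_of_neg hα hε) fun θ hθ =>
      -- The parameter `θ ^ (p / q)` is chosen so that its power `q / p` is `θ`; the criterion is
      -- applied with `q` as radial exponent.
      ⟨radialWeight α p (θ ^ (p / q)), 1, measurable_radialWeight _ _ _, one_ne_zero,
        ENNReal.one_ne_top, fun x hx => ?_⟩
    rw [setLIntegral_dilationPi_radialWeight hq hqp (Real.rpow_pos_of_pos hθ _) hx, one_mul,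
      ← Real.rpow_mul hθ.le, div_mul_div_cancel₀ hq.ne', div_self hp.ne', Real.rpow_one]
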